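/- Let $M$ be a smooth ($C^\infty$) finite-dimensional manifold without boundary, with a fixed metric $d_M$ inducing its topology. Let $\Omega\subset\mathbb{R}^m$ be a convex compact neighborhood of $0$ and let $X_0,\dots,X_m$ be $C^\infty$ vector fields on $M$. Consider the control-affine system $$\dot x(t)=X_0(x(t))+\sum_{i=1}^m u_i(t)X_i(x(t)),\qquad u\in\mathcal{U}:=\{u\in L^\infty(\mathbb{R},\mathbb{R}^m): u(t)\in\Omega\text{ for almost all }t\in\mathbb{R}\},$$ and assume that for all $u\in\mathcal{U}$ and $x\in M$ there is a unique Carathéodory solution $\varphi(t,x,u)$, $t\in\mathbb{R}$, with $\varphi(0,x,u)=x$. Endow $\mathcal{U}$ with a metric $d_{\mathcal U}$ inducing the weak$^*$ topology of $L^\infty(\mathbb{R},\mathbb{R}^m)=L^1(\mathbb{R},\mathbb{R}^m)^*$, endow $\mathcal{U}\times M$ with the metric $d((u,x),(v,y))=\max\{d_{\mathcal U}(u,v),d_M(x,y)\}$, and let $\Phi_t(u,x)=(u(t+\cdot),\varphi(t,x,u))$, $t\in\mathbb{R}$, be the control flow on $\mathcal{U}\times M$. For a metric space $X$ let $\mathcal{P}(X)$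 be the set of continuous functions $\varepsilon:X\to(0,\infty)$. A set $Y\subset\mathcal{U}\times M$ is invariant if $\Phi_t(Y)\subset Y$ for all $t\in\mathbb{R}$. It is strongly chain transitive if for all $p,q\in Y$, all $T>0$ and all $\varepsilon\in\mathcal{P}(\mathcal{U}\times M)$ there are $k\ge1$, points $p_0=p,p_1,\dots,p_k=q$ in $\mathcal{U}\times M$ and times $T_0,\dots,T_{k-1}\ge T$ with $d(\Phi_{T_j}(p_j),p_{j+1})<\varepsilon(\Phi_{T_j}(p_j))$ for $j=0,\dots,k-1$. A maximal invariant strongly chain transitive set is a set that is maximal, with respect to inclusion, among the nonempty invariant strongly chain transitive sets. A point $x\in M$ is strongly chain controllable to $y\in M$ if for all $T>0$ and all $\varepsilon\in\mathcal{P}(M)$ there are $k\ge1$, points $x_0=x,x_1,\dots,x_k=y$ in $M$, controls $u_0,\dots,u_{k-1}\in\mathcal{U}$ and times $T_0,\dots,T_{k-1}\ge T$ with $d_M(\varphi(T_j,x_j,u_j),x_{j+1})<\varepsilon(\varphi(T_j,x_j,u_j))$ for $j=0,\dots,k-1$. A nonempty set $E^*\subset M$ is a strong chain control set if (a) every $x\in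 E^*$ is strongly chain controllable to every $y\in E^*$, (b) for every $x\in E^*$ there is $u\in\mathcal{U}$ with $\varphi(t,x,u)\in E^*$ for all $t\in\mathbb{R}$, and (c) $E^*$ is maximal with these properties. Then: (i) If $E^*\subset M$ is a strong chain control set, then $$\mathcal{E}^*:=\{(u,x)\in\mathcal{U}\times M:\varphi(t,x,u)\in E^*\text{ for all }t\in\mathbb{R}\}$$ is a maximal invariant strongly chain transitive set for $\Phi$. (ii) Conversely, if $\mathcal{E}^*\subset\mathcal{U}\times M$ is a maximal invariant strongly chain transitive set for $\Phi$, then $$E^*:=\{x\in M:\text{there is }u\in\mathcal{U}\text{ with }(u,x)\in\mathcal{E}^*\}$$ is a strong chain control set. -/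

import Mathlib

open MeasureTheory Set
open scoped ENNReal Topology Manifold ContDiff

/-- The admissible controls: classes `u ∈ L^∞(ℝ, ℝ^m)` with `u(t) ∈ Ω` for almost all `t ∈ ℝ`. -/
structure Control {m : ℕ} (Ω : Set (EuclideanSpace ℝ (Fin m))) where
  toLp : Lp (EuclideanSpace ℝ (Fin m)) ∞ (volume : Measure ℝ)
  mem : ∀ᵐ t : ℝ, toLp t ∈ Ω

namespace Control

variable {m : ℕ} {Ω : Set (EuclideanSpace ℝ (Fin m))}

/-- The shifted control `u(t + ·)`. -/
noncomputable def shift (t : ℝ) (u : Control Ω) : Control Ω where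
  toLp := Lp.compMeasurePreserving (fun s : ℝ => t + s) (measurePreserving_add_left volume t) u.toLp
  mem := by
    filter_upwards [Lp.coeFn_compMeasurePreserving u.toLp (measurePreserving_add_left volume t),
      (measurePreserving_add_left (volume : Measure ℝ) t).quasiMeasurePreserving.ae u.mem]
      with s hs hm
    rw [hs]
    exact hm

/-- The trace on the set of controls of the weak-* topology of `L^∞ = (L^1)^*`: the coarsest
topology for which all maps `u ↦ ∫ ⟨u(t), y(t)⟩ dt`, `y ∈ L^1(ℝ, ℝ^m)`, are continuous. -/
noncomputable def weakStarTopology (Ω : Set (EuclideanSpace ℝ (Fin m))) :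
    TopologicalSpace (Control Ω) :=
  TopologicalSpace.induced
    (fun (u : Control Ω) (y : Lp (EuclideanSpace ℝ (Fin m)) 1 (volume : Measure ℝ)) =>
      ∫ t : ℝ, inner ℝ (u.toLp t) (y t))
    Pi.topologicalSpace

end Control

/-- A curve in a manifold is locally absolutely continuous if it is continuous and, around every
time, it is absolutely continuous in a chart. -/
def IsLocallyAbsolutelyContinuous {n : ℕ} {M : Type*} [TopologicalSpace M]
    [ChartedSpace (EuclideanSpace ℝ (Fin n)) M] (γ : ℝ → M) : Prop :=
  Continuous γ ∧ ∀ t₀ : ℝ, ∃ a b : ℝ, a < t₀ ∧ t₀ < b ∧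
    (∀ t ∈ Icc a b, γ t ∈ (chartAt (EuclideanSpace ℝ (Fin n)) (γ t₀)).source) ∧
    AbsolutelyContinuousOnInterval
      (fun t => chartAt (EuclideanSpace ℝ (Fin n)) (γ t₀) (γ t)) a b

/-- The data of a control-affine system
`x'(t) = X₀(x(t)) + ∑ i, u_i(t) X_i(x(t))`, `u(t) ∈ Ω`, on an `n`-dimensional smooth manifold. -/
structure ControlAffineSystem (n m : ℕ) (M : Type*) [TopologicalSpace M]
    [ChartedSpace (EuclideanSpace ℝ (Fin n)) M] [IsManifold (𝓡 n) ∞ M] where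
  /-- the control range -/
  Ω : Set (EuclideanSpace ℝ (Fin m))
  convex : Convex ℝ Ω
  isCompact : IsCompact Ω
  mem_nhds : Ω ∈ 𝓝 (0 : EuclideanSpace ℝ (Fin m))
  /-- the drift vector field -/
  X₀ : (x : M) → TangentSpace (𝓡 n) x
  /-- the control vector fields -/
  X : Fin m → (x : M) → TangentSpace (𝓡 n) x
  smooth_X₀ : ContMDiff (𝓡 n) (𝓡 n).tangent ∞ (fun x => (⟨x, X₀ x⟩ : TangentBundle (𝓡 n) M))
  smooth_X : ∀ i, ContMDiff (𝓡 n) (𝓡 n).tangent ∞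
    (fun x => (⟨x, X i x⟩ : TangentBundle (𝓡 n) M))

namespace ControlAffineSystem

variable {n m : ℕ} {M : Type*} [MetricSpace M] [ChartedSpace (EuclideanSpace ℝ (Fin n)) M]
  [IsManifold (𝓡 n) ∞ M]

/-- `γ : ℝ → M` is a Carathéodory solution for the control `u`. -/
def IsSolution (S : ControlAffineSystem n m M) (u : Control S.Ω) (γ : ℝ → M) : Prop :=
  IsLocallyAbsolutelyContinuous (n := n) γ ∧
    ∀ᵐ t : ℝ, HasMFDerivAt 𝓘(ℝ, ℝ) (𝓡 n) γ t
      ((1 : ℝ →L[ℝ] ℝ).smulRight (S.X₀ (γ t) + ∑ i, u.toLp t i • S.X i (γ t)))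

/-- For every control and every initial state there is a unique solution on all of `ℝ`. -/
def UniqueGlobalSolutions (S : ControlAffineSystem n m M) : Prop :=
  ∀ (u : Control S.Ω) (x : M), ∃! γ : ℝ → M, S.IsSolution u γ ∧ γ 0 = x

/-- The solution `φ(t, x, u)`. -/
noncomputable def φ (S : ControlAffineSystem n m M) (hS : S.UniqueGlobalSolutions)
    (t : ℝ) (x : M) (u : Control S.Ω) : M :=
  (hS u x).choose t

/-- The control flow `Φ_t(u, x) = (u(t + ·), φ(t, x, u))` on the product of the set of controls
and `M`. -/
noncomputable def controlFlow (S : ControlAffineSystem n m M) (hS : S.UniqueGlobalSolutions)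
    (t : ℝ) (p : Control S.Ω × M) : Control S.Ω × M :=
  (p.1.shift t, S.φ hS t p.2 p.1)

end ControlAffineSystem

/-- The jump functions on `X`: continuous functions with values in `(0, ∞)`. -/
def IsJumpFunction {X : Type*} [TopologicalSpace X] (ε : X → ℝ) : Prop :=
  Continuous ε ∧ ∀ x, 0 < ε x

/-- There is an `(ε, T)`-chain from `x` to `y` for the flow `Ψ`. -/
def HasChain {X : Type*} [MetricSpace X] (Ψ : ℝ → X → X) (ε : X → ℝ) (T : ℝ) (x y : X) : Prop :=
  ∃ (k : ℕ) (p : ℕ → X) (τ : ℕ → ℝ), 1 ≤ k ∧ p 0 = x ∧ p k = y ∧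
    ∀ j < k, T ≤ τ j ∧ dist (Ψ (τ j) (p j)) (p (j + 1)) < ε (Ψ (τ j) (p j))

/-- Strong chain transitivity of a set for the flow `Ψ`. -/
def IsStronglyChainTransitive {X : Type*} [MetricSpace X] (Ψ : ℝ → X → X) (Y : Set X) : Prop :=
  ∀ x ∈ Y, ∀ y ∈ Y, ∀ T : ℝ, 0 < T → ∀ ε : X → ℝ, IsJumpFunction ε → HasChain Ψ ε T x y

/-- The maximal nonempty invariant strongly chain transitive sets of the flow `Ψ`. -/
def IsMaximalInvariantStronglyChainTransitive {X : Type*} [MetricSpace X] (Ψ : ℝ → X → X)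
    (Y : Set X) : Prop :=
  Maximal (fun Z : Set X => Z.Nonempty ∧ IsInvariant Ψ Z ∧ IsStronglyChainTransitive Ψ Z) Y

namespace ControlAffineSystem

variable {n m : ℕ} {M : Type*} [MetricSpace M] [ChartedSpace (EuclideanSpace ℝ (Fin n)) M]
  [IsManifold (𝓡 n) ∞ M]

/-- There is a controlled `(ε, T)`-chain from `x` to `y`. -/
def HasControlledChain (S : ControlAffineSystem n m M) (hS : S.UniqueGlobalSolutions)
    (ε : M → ℝ) (T : ℝ) (x y : M) : Prop :=
  ∃ (k : ℕ) (p : ℕ → M) (u : ℕ → Control S.Ω) (τ : ℕ → ℝ), 1 ≤ k ∧ p 0 = x ∧ p k = y ∧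
    ∀ j < k, T ≤ τ j ∧
      dist (S.φ hS (τ j) (p j) (u j)) (p (j + 1)) < ε (S.φ hS (τ j) (p j) (u j))

/-- The point `x` is strongly chain controllable to the point `y`. -/
def StronglyChainControllable (S : ControlAffineSystem n m M) (hS : S.UniqueGlobalSolutions)
    (x y : M) : Prop :=
  ∀ T : ℝ, 0 < T → ∀ ε : M → ℝ, IsJumpFunction ε → S.HasControlledChain hS ε T x y

/-- Strong chain control sets. -/
def IsStrongChainControlSet (S : ControlAffineSystem n m M) (hS : S.UniqueGlobalSolutions)
    (E : Set M) : Prop :=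
  Maximal (fun F : Set M => F.Nonempty ∧
    (∀ x ∈ F, ∀ y ∈ F, S.StronglyChainControllable hS x y) ∧
    (∀ x ∈ F, ∃ u : Control S.Ω, ∀ t : ℝ, S.φ hS t x u ∈ F)) E

/-- The lift of a subset of `M` to the product of the set of controls and `M`. -/
def lift (S : ControlAffineSystem n m M) (hS : S.UniqueGlobalSolutions) (E : Set M) :
    Set (Control S.Ω × M) :=
  {p | ∀ t : ℝ, S.φ hS t p.2 p.1 ∈ E}

end ControlAffineSystem

/-! Lifting and projecting both preserve the defining properties apart from maximality. Maximality
then transfers because an invariant `Z` lies in the lift of `E` exactly when its projection lies in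
`E`, and because a set with property (b) lies in the projection of its lift.

Projecting chains is easy: use jump functions that depend on the state only
(`stronglyChainControllable_of_mem`). Lifting a chain from `x` to `y` to one from `(u, x)` to `(v,
y)` is the substance (`isStronglyChainTransitive_lift`). The control space is weak-* compact
(`Control.compactSpace`), so a jump function on the product dominates one on `M`. Since a solution
on `[0, τ]` sees only the control there (`φ_congr`), the controls of a chain can be concatenated
into one control, and all inner jumps happen in `M` alone. Control jumps remain only near the two
ends. They are small because controls that agree on a long interval around `0` are weak-* close
(`Control.exists_forall_dist_lt`). -/

namespace AbsolutelyContinuousOnInterval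

/-! ### Reparametrizing and gluing absolutely continuous curves -/

variable {X : Type*} [PseudoMetricSpace X] {f g : ℝ → X} {a b c d : ℝ}

theorem congr_uIcc (hf : AbsolutelyContinuousOnInterval f a b) (h : EqOn f g (uIcc a b)) :
    AbsolutelyContinuousOnInterval g a b := by
  rw [absolutelyContinuousOnInterval_iff] at hf ⊢
  intro ε hε
  obtain ⟨δ, hδ, H⟩ := hf ε hε
  refine ⟨δ, hδ, fun E hE hlt => ?_⟩
  refine lt_of_eq_of_lt (Finset.sum_congr rfl fun i hi => ?_) (H E hE hlt)
  rw [h (hE.1 i hi).1, h (hE.1 i hi).2]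

/-- Absolute continuity is preserved by monotone nonexpanding changes of the parameter. -/
theorem comp_monotone (hf : AbsolutelyContinuousOnInterval f a b) {h : ℝ → ℝ} (hm : Monotone h)
    (hl : ∀ x y, dist (h x) (h y) ≤ dist x y) (hmaps : MapsTo h (uIcc c d) (uIcc a b)) :
    AbsolutelyContinuousOnInterval (fun t => f (h t)) c d := by
  rw [absolutelyContinuousOnInterval_iff] at hf ⊢
  intro ε hε
  obtain ⟨δ, hδ, H⟩ := hf ε hε
  refine ⟨δ, hδ, fun E hE hlt => ?_⟩
  refine H (E.1, fun i => (h (E.2 i).1, h (E.2 i).2)) ⟨fun i hi =>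
    ⟨hmaps (hE.1 i hi).1, hmaps (hE.1 i hi).2⟩, fun i hi j hj hij => ?_⟩
    ((Finset.sum_le_sum fun i _ => hl _ _).trans_lt hlt)
  have hd := Set.disjoint_left.1 (hE.2 hi hj hij)
  refine Set.disjoint_left.2 fun z hz hz' => ?_
  simp only [uIoc, mem_Ioc, ← hm.map_min, ← hm.map_max] at hz hz' hd
  have h1 := hm.reflect_lt (hz.1.trans_le hz.2)
  have h2 := hm.reflect_lt (hz.1.trans_le hz'.2)
  have h3 := hm.reflect_lt (hz'.1.trans_le hz.2)
  have h4 := hm.reflect_lt (hz'.1.trans_le hz'.2)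
  -- If the image intervals overlap, each left end lies strictly below each right end, so the
  -- smaller right end belongs to both original intervals.
  exact hd (a := min (max (E.2 i).1 (E.2 i).2) (max (E.2 j).1 (E.2 j).2))
    ⟨lt_min h1 h2, min_le_left _ _⟩ ⟨lt_min h3 h4, min_le_right _ _⟩

/-- Two absolutely continuous functions that agree at a common end point of their intervals can
be glued. -/
theorem glue {F : Type*} [SeminormedAddCommGroup F] {f g : ℝ → F} (hac : a ≤ c) (hcb : c ≤ b)
    (hf : AbsolutelyContinuousOnInterval f a c) (hg : AbsolutelyContinuousOnInterval g c b)
    (hfg : f c = g c) :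
    AbsolutelyContinuousOnInterval (fun t => if t ≤ c then f t else g t) a b := by
  -- The glued function equals `f (min t c) + g (max t c) - f c`, a combination of absolutely
  -- continuous functions.
  have h1 : AbsolutelyContinuousOnInterval (fun t => f (min t c)) a b := by
    refine hf.comp_monotone (fun x y hxy => min_le_min_right _ hxy) (fun x y => ?_) ?_
    · simpa [Real.dist_eq] using abs_min_sub_min_le_max x c y c
    · intro t ht
      rw [uIcc_of_le (hac.trans hcb)] at ht
      rw [uIcc_of_le hac]
      exact ⟨le_min ht.1 hac, min_le_right _ _⟩
  have h2 : AbsolutelyContinuousOnInterval (fun t => g (max t c)) a b := by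
    refine hg.comp_monotone (fun x y hxy => max_le_max_right _ hxy) (fun x y => ?_) ?_
    · simpa [Real.dist_eq] using abs_max_sub_max_le_max x c y c
    · intro t ht
      rw [uIcc_of_le (hac.trans hcb)] at ht
      rw [uIcc_of_le hcb]
      exact ⟨le_max_right _ _, max_le ht.2 hcb⟩
  have h3 : AbsolutelyContinuousOnInterval (fun _ => f c) a b :=
    (LipschitzWith.const (f c)).lipschitzOnWith.absolutelyContinuousOnInterval
  refine ((h1.add h2).sub h3).congr_uIcc fun t _ => ?_
  by_cases ht : t ≤ c
  · simp [ht, hfg]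
  · simp [ht, (not_le.1 ht).le]

end AbsolutelyContinuousOnInterval

namespace IsLocallyAbsolutelyContinuous

variable {n : ℕ} {M : Type*} [TopologicalSpace M] [ChartedSpace (EuclideanSpace ℝ (Fin n)) M]
  {γ γ₁ γ₂ : ℝ → M}

theorem comp_const_add (h : IsLocallyAbsolutelyContinuous (n := n) γ) (s : ℝ) :
    IsLocallyAbsolutelyContinuous (n := n) (fun t => γ (s + t)) := by
  refine ⟨h.1.comp (continuous_const.add continuous_id), fun t₀ => ?_⟩
  obtain ⟨a, b, ha, hb, hsrc, hac⟩ := h.2 (s + t₀)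
  refine ⟨a - s, b - s, by linarith, by linarith, fun t ht => hsrc _ ?_, ?_⟩
  · exact ⟨by linarith [ht.1], by linarith [ht.2]⟩
  · refine hac.comp_monotone (h := fun t => s + t) (fun x y hxy => by simpa using hxy)
      (fun x y => by simp) fun t ht => ?_
    rw [uIcc_of_le (by linarith)] at ht
    rw [uIcc_of_le (by linarith)]
    exact ⟨by linarith [ht.1], by linarith [ht.2]⟩

theorem glue {c : ℝ} (h₁ : IsLocallyAbsolutelyContinuous (n := n) γ₁)
    (h₂ : IsLocallyAbsolutelyContinuous (n := n) γ₂) (hc : γ₁ c = γ₂ c) :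
    IsLocallyAbsolutelyContinuous (n := n) (fun t => if t ≤ c then γ₁ t else γ₂ t) := by
  refine ⟨h₁.1.if_le h₂.1 continuous_id continuous_const (by rintro t rfl; exact hc),
    fun t₀ => ?_⟩
  beta_reduce
  rcases lt_trichotomy t₀ c with h | rfl | h
  · obtain ⟨a, b, ha, hb, hsrc, hac⟩ := h₁.2 t₀
    have key : ∀ t ∈ Icc a (min b c), (if t ≤ c then γ₁ t else γ₂ t) = γ₁ t := fun t ht =>
      if_pos (ht.2.trans (min_le_right _ _))
    have hlt : t₀ < min b c := lt_min hb h
    refine ⟨a, min b c, ha, hlt, fun t ht => ?_, ?_⟩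
    · rw [key t ht, if_pos h.le]
      exact hsrc t ⟨ht.1, ht.2.trans (min_le_left _ _)⟩
    · rw [if_pos h.le]
      refine (hac.mono ?_).congr_uIcc fun t ht => ?_
      · rw [uIcc_of_le (by linarith), uIcc_of_le (by linarith)]
        exact Icc_subset_Icc_right (min_le_left _ _)
      · rw [uIcc_of_le (by linarith)] at ht
        rw [key t ht]
  · obtain ⟨a, b', ha, hb', hsrc, hac⟩ := h₁.2 t₀
    obtain ⟨a', b, ha', hb, hsrc', hac'⟩ := h₂.2 t₀
    -- Both curves pass through the same point at the junction, hence are read in the same chart.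
    rw [← hc] at hsrc' hac'
    refine ⟨a, b, ha, hb, fun t ht => ?_, ?_⟩
    · rw [if_pos le_rfl]
      by_cases htt : t ≤ t₀
      · rw [if_pos htt]
        exact hsrc t ⟨ht.1, htt.trans hb'.le⟩
      · rw [if_neg htt]
        exact hsrc' t ⟨ha'.le.trans (not_le.1 htt).le, ht.2⟩
    · rw [if_pos le_rfl]
      refine (AbsolutelyContinuousOnInterval.glue ha.le hb.le (hac.mono ?_) (hac'.mono ?_)
        (by rw [hc])).congr_uIcc fun t _ => ?_
      · rw [uIcc_of_le (by linarith), uIcc_of_le (by linarith)]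
        exact Icc_subset_Icc_right hb'.le
      · rw [uIcc_of_le (by linarith), uIcc_of_le (by linarith)]
        exact Icc_subset_Icc_left ha'.le
      · simp only
        split_ifs <;> rfl
  · obtain ⟨a, b, ha, hb, hsrc, hac⟩ := h₂.2 t₀
    obtain ⟨a', ha', hca'⟩ := exists_between (max_lt ha h)
    have key : ∀ t ∈ Icc a' b, (if t ≤ c then γ₁ t else γ₂ t) = γ₂ t := fun t ht =>
      if_neg (not_le.2 ((le_max_right _ _).trans_lt (ha'.trans_le ht.1)))
    have haa : a ≤ a' := (le_max_left _ _).trans ha'.le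
    refine ⟨a', b, hca', hb, fun t ht => ?_, ?_⟩
    · rw [key t ht, if_neg h.not_ge]
      exact hsrc t ⟨haa.trans ht.1, ht.2⟩
    · rw [if_neg h.not_ge]
      refine (hac.mono ?_).congr_uIcc fun t ht => ?_
      · rw [uIcc_of_le (by linarith), uIcc_of_le (by linarith)]
        exact Icc_subset_Icc_left haa
      · rw [uIcc_of_le (by linarith)] at ht
        rw [key t ht]

end IsLocallyAbsolutelyContinuous

/-! ### Shifting and concatenating controls -/

namespace Control

variable {m : ℕ} {Ω : Set (EuclideanSpace ℝ (Fin m))}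

theorem ae_shift (t : ℝ) (u : Control Ω) : ∀ᵐ s : ℝ, (u.shift t).toLp s = u.toLp (t + s) :=
  Lp.coeFn_compMeasurePreserving u.toLp (measurePreserving_add_left volume t)

theorem ae_comp_const_add {p : ℝ → Prop} (h : ∀ᵐ t : ℝ, p t) (s : ℝ) : ∀ᵐ t : ℝ, p (s + t) :=
  (measurePreserving_add_left (volume : Measure ℝ) s).quasiMeasurePreserving.ae h

theorem exists_of_ae_mem {f : ℝ → EuclideanSpace ℝ (Fin m)} (hf : MemLp f ∞ volume)
    (hΩ : ∀ᵐ t, f t ∈ Ω) : ∃ u : Control Ω, ∀ᵐ t, u.toLp t = f t := by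
  refine ⟨⟨hf.toLp f, ?_⟩, hf.coeFn_toLp⟩
  filter_upwards [hf.coeFn_toLp, hΩ] with t h1 h2
  rwa [h1]

/-- Concatenation of two controls at the time `c`. -/
theorem exists_concat (c : ℝ) (u v : Control Ω) :
    ∃ w : Control Ω, ∀ᵐ t, w.toLp t = if t < c then u.toLp t else v.toLp t := by
  classical
  refine exists_of_ae_mem ?_ ?_
  · exact MemLp.piecewise (s := Iio c) measurableSet_Iio ((Lp.memLp u.toLp).restrict _)
      ((Lp.memLp v.toLp).restrict _)
  · filter_upwards [u.mem, v.mem] with t h1 h2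
    split_ifs <;> assumption

end Control

/-! ### Solutions: gluing, cocycle property, dependence on the control -/

namespace ControlAffineSystem

variable {n m : ℕ} {M : Type*} [MetricSpace M] [ChartedSpace (EuclideanSpace ℝ (Fin n)) M]
  [IsManifold (𝓡 n) ∞ M] {S : ControlAffineSystem n m M}

/-- The right-hand side of the system, as a map into the model space. -/
noncomputable def rhs (S : ControlAffineSystem n m M) (w : EuclideanSpace ℝ (Fin m)) (x : M) :
    EuclideanSpace ℝ (Fin n) :=
  S.X₀ x + ∑ i, w i • S.X i x

theorem hasMFDerivAt_congr {γ γ' : ℝ → M} {t : ℝ} {w w' : EuclideanSpace ℝ (Fin m)}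
    (h : HasMFDerivAt 𝓘(ℝ, ℝ) (𝓡 n) γ t
      ((1 : ℝ →L[ℝ] ℝ).smulRight (S.X₀ (γ t) + ∑ i, w i • S.X i (γ t))))
    (hγ : γ' =ᶠ[𝓝 t] γ) (hw : w' = w) :
    HasMFDerivAt 𝓘(ℝ, ℝ) (𝓡 n) γ' t
      ((1 : ℝ →L[ℝ] ℝ).smulRight (S.X₀ (γ' t) + ∑ i, w' i • S.X i (γ' t))) := by
  subst hw
  have h' := h.congr_of_eventuallyEq hγ
  -- The tangent spaces at the two base points are distinct types; `rhs` takes values in the common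
  -- model space, where the base point can be rewritten.
  have e : S.rhs w' (γ' t) = S.rhs w' (γ t) := by rw [hγ.eq_of_nhds]
  have e2 : ((1 : ℝ →L[ℝ] ℝ).smulRight (S.rhs w' (γ' t))) =
    ((1 : ℝ →L[ℝ] ℝ).smulRight (S.rhs w' (γ t))) := by rw [e]
  exact h'.congr_mfderiv e2.symm

theorem IsSolution.shift {u : Control S.Ω} {γ : ℝ → M} (h : S.IsSolution u γ) (s : ℝ) :
    S.IsSolution (u.shift s) (fun t => γ (s + t)) := by
  refine ⟨h.1.comp_const_add s, ?_⟩
  filter_upwards [u.ae_shift s, Control.ae_comp_const_add h.2 s] with t hu ht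
  have hd : HasMFDerivAt 𝓘(ℝ, ℝ) 𝓘(ℝ, ℝ) (fun t : ℝ => s + t) t (ContinuousLinearMap.id ℝ ℝ) :=
    ((hasFDerivAt_id t).const_add s).hasMFDerivAt
  rw [hu]
  exact HasMFDerivAt.comp t ht hd

theorem IsSolution.glue {u u₁ u₂ : Control S.Ω} {γ₁ γ₂ : ℝ → M} {c : ℝ}
    (h₁ : S.IsSolution u₁ γ₁) (h₂ : S.IsSolution u₂ γ₂) (hc : γ₁ c = γ₂ c)
    (hu₁ : ∀ᵐ t : ℝ, t < c → u.toLp t = u₁.toLp t)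
    (hu₂ : ∀ᵐ t : ℝ, c < t → u.toLp t = u₂.toLp t) :
    S.IsSolution u (fun t => if t ≤ c then γ₁ t else γ₂ t) := by
  refine ⟨h₁.1.glue h₂.1 hc, ?_⟩
  have hne : ∀ᵐ t : ℝ, t ≠ c := by simp [ae_iff]
  filter_upwards [h₁.2, h₂.2, hu₁, hu₂, hne] with t h1 h2 hu1 hu2 hne
  rcases lt_or_gt_of_ne hne with h | h
  · refine hasMFDerivAt_congr h1 ?_ (hu1 h)
    filter_upwards [Iio_mem_nhds h] with s hs
    exact if_pos (le_of_lt hs)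
  · refine hasMFDerivAt_congr h2 ?_ (hu2 h)
    filter_upwards [Ioi_mem_nhds h] with s hs
    exact if_neg (not_le.2 hs)

variable (hS : S.UniqueGlobalSolutions)

theorem isSolution_φ (x : M) (u : Control S.Ω) : S.IsSolution u (fun t => S.φ hS t x u) :=
  (hS u x).choose_spec.1.1

@[simp]
theorem φ_zero (x : M) (u : Control S.Ω) : S.φ hS 0 x u = x :=
  (hS u x).choose_spec.1.2

theorem IsSolution.eq_φ {u : Control S.Ω} {γ : ℝ → M} (h : S.IsSolution u γ) (t : ℝ) :
    γ t = S.φ hS t (γ 0) u :=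
  congrFun ((hS u (γ 0)).choose_spec.2 γ ⟨h, rfl⟩) t

/-- The cocycle property. -/
theorem φ_φ_shift (s t : ℝ) (x : M) (u : Control S.Ω) :
    S.φ hS t (S.φ hS s x u) (u.shift s) = S.φ hS (s + t) x u := by
  have h := ((isSolution_φ hS x u).shift s).eq_φ hS t
  simp only [add_zero] at h
  exact h.symm

/-- Solutions in forward time depend only on the values of the control in between. -/
theorem φ_congr {b : ℝ} (hb : 0 ≤ b) (x : M) {u v : Control S.Ω}
    (huv : ∀ᵐ t : ℝ, 0 ≤ t → t < b → u.toLp t = v.toLp t) : S.φ hS b x u = S.φ hS b x v := by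
  obtain ⟨w, hw⟩ := Control.exists_concat b v u
  have h₁ := isSolution_φ hS x v
  have h₂ := (isSolution_φ hS (S.φ hS b x v) (u.shift b)).shift (-b)
  have hw₂ : ∀ᵐ t : ℝ, ((u.shift b).shift (-b)).toLp t = u.toLp t := by
    filter_upwards [(u.shift b).ae_shift (-b), Control.ae_comp_const_add (u.ae_shift b) (-b)]
      with t h1 h2
    rw [h1, h2]
    simp
  have h₃ := h₁.glue (u := w) h₂ (c := b) (by simp)
    (by filter_upwards [hw] with t ht hlt; rw [ht, if_pos hlt])
    (by filter_upwards [hw, hw₂] with t ht ht2 hlt; rw [ht, if_neg hlt.not_gt, ht2])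
  -- The glued curve follows `u` up to time `0`, `v` up to `b`, then `u` again. It solves the
  -- equation for `u` on all of `ℝ`, so global uniqueness applies.
  have h₄ := (isSolution_φ hS x u).glue (u := u) h₃ (c := 0) (by simp [hb])
    (by simp)
    (by
      filter_upwards [hw, huv] with t ht ht2 hlt
      rw [ht]
      split_ifs with h
      · exact ht2 hlt.le h
      · rfl)
  have h₅ := h₄.eq_φ hS b
  simp only [le_refl, if_true, φ_zero] at h₅
  rw [← h₅]
  split_ifs with h
  · rw [le_antisymm h hb, φ_zero, φ_zero]
  · rfl

end ControlAffineSystem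

/-! ### The weak-* topology on controls: compactness and closeness -/

open Filter in
/-- In a Hilbert space every ultrafilter on a bounded closed convex set converges weakly to a point
of this set. -/
theorem Convex.exists_tendsto_inner_ultrafilter {H ι : Type*} [NormedAddCommGroup H]
    [InnerProductSpace ℝ H] [CompleteSpace H] {K : Set H} (hconv : Convex ℝ K)
    (hclosed : IsClosed K) (hbdd : Bornology.IsBounded K) (F : Ultrafilter ι) {J : ι → H}
    (hJ : ∀ i, J i ∈ K) :
    ∃ g ∈ K, ∀ f, Tendsto (fun i => inner ℝ (J i) f) F (𝓝 (inner ℝ g f)) := by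
  obtain ⟨B, hB⟩ := hbdd.exists_norm_le
  let D : ι → WeakDual ℝ H := fun i =>
    StrongDual.toWeakDual (InnerProductSpace.toDual ℝ H (J i))
  have hD : ∀ᶠ l in (F.map D : Filter (WeakDual ℝ H)),
      l ∈ WeakDual.toStrongDual ⁻¹' Metric.closedBall (0 : StrongDual ℝ H) B := by
    refine Filter.Eventually.of_forall (f := (F : Filter ι)) fun i => ?_
    simp only [mem_preimage, D, mem_closedBall_zero_iff]
    exact ((InnerProductSpace.toDual ℝ H).norm_map (J i)).trans_le (hB _ (hJ i))
  -- Banach–Alaoglu in the dual, which Riesz identifies with `H`.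
  obtain ⟨l, -, hl⟩ := (WeakDual.isCompact_closedBall (𝕜 := ℝ) (0 : StrongDual ℝ H) B)
    |>.ultrafilter_le_nhds (F.map D) (le_principal_iff.2 hD)
  let g : H := (InnerProductSpace.toDual ℝ H).symm (WeakDual.toStrongDual l)
  have hg : ∀ f, Tendsto (fun i => inner ℝ (J i) f) F (𝓝 (inner ℝ g f)) := by
    intro f
    have h1 : Tendsto D F (𝓝 l) := hl
    have h2 := ((WeakDual.eval_continuous f).tendsto l).comp h1
    have e : inner ℝ g f = l f := by
      simp [g]
    rw [e]
    exact h2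
  refine ⟨g, ?_, hg⟩
  -- A weak limit outside `K` would be strictly separated from `K` by a functional, contradicting
  -- convergence of its values.
  by_contra hgK
  obtain ⟨a, s, ha, hs⟩ := geometric_hahn_banach_closed_point hconv hclosed hgK
  have e : ∀ x, a x = inner ℝ x ((InnerProductSpace.toDual ℝ H).symm a) := fun x => by
    rw [real_inner_comm]; simp
  have h3 := hg ((InnerProductSpace.toDual ℝ H).symm a)
  simp only [← e] at h3
  exact absurd (le_of_tendsto h3 (Eventually.of_forall fun i => (ha _ (hJ i)).le)) (not_le.2 hs)

theorem convex_setOf_ae_smul_mem {E : Type*} [NormedAddCommGroup E] [NormedSpace ℝ E] {Ω : Set E}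
    (hΩ : Convex ℝ Ω) (p : ℝ≥0∞) (r : ℝ → ℝ) :
    Convex ℝ {f : Lp E p (volume : Measure ℝ) | ∀ᵐ t, r t • f t ∈ Ω} := by
  intro f hf g hg a b ha hb hab
  filter_upwards [hf, hg, Lp.coeFn_add (a • f) (b • g), Lp.coeFn_smul a f, Lp.coeFn_smul b g]
    with t h1 h2 h3 h4 h5
  rw [h3, Pi.add_apply, h4, h5, Pi.smul_apply, Pi.smul_apply, smul_add, smul_comm, smul_comm _ b]
  exact hΩ h1 h2 ha hb hab

theorem isClosed_setOf_ae_smul_mem {E : Type*} [NormedAddCommGroup E] [NormedSpace ℝ E]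
    {Ω : Set E} (hΩ : IsClosed Ω) (p : ℝ≥0∞) [Fact (1 ≤ p)] (r : ℝ → ℝ) :
    IsClosed {f : Lp E p (volume : Measure ℝ) | ∀ᵐ t, r t • f t ∈ Ω} := by
  refine IsSeqClosed.isClosed fun f f₀ hf h => ?_
  obtain ⟨ns, -, hns⟩ := (tendstoInMeasure_of_tendsto_Lp h).exists_seq_tendsto_ae
  filter_upwards [ae_all_iff.2 hf, hns] with t h1 h2
  exact hΩ.mem_of_tendsto (h2.const_smul (r t)) (Filter.Eventually.of_forall fun i => h1 _)

namespace Control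

variable {m : ℕ} {Ω : Set (EuclideanSpace ℝ (Fin m))}

open Filter in
theorem tendsto_nhds_iff [τ : TopologicalSpace (Control Ω)] (hτ : τ = weakStarTopology Ω)
    {ι : Type*} {l : Filter ι} {f : ι → Control Ω} {u : Control Ω} :
    Tendsto f l (𝓝 u) ↔ ∀ y : Lp (EuclideanSpace ℝ (Fin m)) 1 (volume : Measure ℝ),
      Tendsto (fun i => ∫ t, inner ℝ ((f i).toLp t) (y t)) l
        (𝓝 (∫ t, inner ℝ (u.toLp t) (y t))) := by
  subst hτ
  unfold weakStarTopology
  rw [nhds_induced, tendsto_comap_iff, tendsto_pi_nhds]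
  rfl

theorem integrable_inner (u : Control Ω) (hΩ : Bornology.IsBounded Ω)
    {y : ℝ → EuclideanSpace ℝ (Fin m)} (hy : Integrable y) :
    Integrable (fun t => inner ℝ (u.toLp t) (y t)) := by
  obtain ⟨C, hC⟩ := hΩ.exists_norm_le
  refine (hy.norm.const_mul C).mono' ((Lp.aestronglyMeasurable _).inner hy.1) ?_
  filter_upwards [u.mem] with t ht
  exact (norm_inner_le_norm _ _).trans (by gcongr; exact hC _ ht)

/-- Makes the pairings equicontinuous in the test function, so convergence need only be checked on a
dense set of test functions. -/
theorem dist_integral_inner_le (u : Control Ω) {C : ℝ} (hC : ∀ x ∈ Ω, ‖x‖ ≤ C)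
    {y z : ℝ → EuclideanSpace ℝ (Fin m)} (hy : Integrable y) (hz : Integrable z) :
    dist (∫ t, inner ℝ (u.toLp t) (y t)) (∫ t, inner ℝ (u.toLp t) (z t)) ≤
      C * ∫ t, ‖y t - z t‖ := by
  have hΩ : Bornology.IsBounded Ω := isBounded_iff_forall_norm_le.2 ⟨C, hC⟩
  rw [Real.dist_eq, ← integral_sub (u.integrable_inner hΩ hy) (u.integrable_inner hΩ hz),
    ← integral_const_mul, ← Real.norm_eq_abs]
  refine norm_integral_le_of_norm_le ((hy.sub hz).norm.const_mul C) ?_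
  filter_upwards [u.mem] with t ht
  rw [← inner_sub_right]
  exact (norm_inner_le_norm _ _).trans (by gcongr; exact hC _ ht)

open Filter in
/-- The set of controls is compact in the weak-* topology. -/
theorem compactSpace [τ : TopologicalSpace (Control Ω)] (hτ : τ = weakStarTopology Ω)
    (hconv : Convex ℝ Ω) (hcomp : IsCompact Ω) : CompactSpace (Control Ω) := by
  obtain ⟨C, hC⟩ := hcomp.isBounded.exists_norm_le
  -- Controls need not be square integrable on `ℝ`. The weight `r` embeds them into a bounded closed
  -- convex subset of `L²`, where weak compactness is available.
  let r : ℝ → ℝ := fun t => (1 + t ^ 2)⁻¹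
  have hr : ∀ t, 0 < r t := fun t => by positivity
  have hr1 : ∀ t, r t ≤ 1 := fun t => inv_le_one_of_one_le₀ (by nlinarith [sq_nonneg t])
  have hrc : Continuous r := Continuous.inv₀ (by fun_prop) fun t => by positivity
  have hrI : Integrable r := integrable_inv_one_add_sq
  have hr2 : MemLp r 2 volume := by
    refine (memLp_two_iff_integrable_sq hrc.aestronglyMeasurable).2
      (hrI.mono' (hrc.pow 2).aestronglyMeasurable (Eventually.of_forall fun t => ?_))
    rw [Real.norm_of_nonneg (sq_nonneg _)]
    nlinarith [hr t, hr1 t]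
  have hmem : ∀ u : Control Ω, MemLp (fun t => r t • u.toLp t) 2 volume := by
    intro u
    refine (hr2.const_mul C).mono'
      (hrc.aestronglyMeasurable.smul (Lp.aestronglyMeasurable _)) ?_
    filter_upwards [u.mem] with t ht
    rw [norm_smul, Real.norm_of_nonneg (hr t).le, mul_comm]
    exact mul_le_mul_of_nonneg_right (hC _ ht) (hr t).le
  let K : Set (Lp (EuclideanSpace ℝ (Fin m)) 2 (volume : Measure ℝ)) :=
    {f | ∀ᵐ t, (r t)⁻¹ • f t ∈ Ω}
  have hKb : Bornology.IsBounded K := by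
    refine isBounded_iff_forall_norm_le.2 ⟨‖(hr2.const_mul C).toLp _‖, fun f hf => ?_⟩
    refine Lp.norm_le_norm_of_ae_le ?_
    filter_upwards [hf, (hr2.const_mul C).coeFn_toLp] with t ht h2
    rw [h2]
    have h3 := hC _ ht
    rw [norm_smul, norm_inv, Real.norm_of_nonneg (hr t).le, inv_mul_le_iff₀ (hr t)] at h3
    exact h3.trans (by rw [mul_comm]; exact le_abs_self _)
  have hJK : ∀ u : Control Ω, (hmem u).toLp _ ∈ K := by
    intro u
    filter_upwards [(hmem u).coeFn_toLp, u.mem] with t h1 h2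
    rwa [h1, inv_smul_smul₀ (hr t).ne']
  refine ⟨isCompact_iff_ultrafilter_le_nhds.2 fun F _ => ?_⟩
  obtain ⟨g, hgK, hg⟩ := (convex_setOf_ae_smul_mem hconv 2 _).exists_tendsto_inner_ultrafilter
    (isClosed_setOf_ae_smul_mem hcomp.isClosed 2 _) hKb F hJK
  obtain ⟨v, hv⟩ : ∃ v : Control Ω, ∀ᵐ t, v.toLp t = (r t)⁻¹ • g t := by
    refine exists_of_ae_mem (memLp_top_of_bound ?_ C ?_) hgK
    · exact (hrc.inv₀ fun t => (hr t).ne').aestronglyMeasurable.smul (Lp.aestronglyMeasurable _)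
    · filter_upwards [hgK] with t ht using hC _ ht
  refine ⟨v, mem_univ _, ?_⟩
  have hpair : ∀ f : ℝ → EuclideanSpace ℝ (Fin m), MemLp f 2 volume →
      Tendsto (fun u : Control Ω => ∫ t, inner ℝ (u.toLp t) (r t • f t)) F
        (𝓝 (∫ t, inner ℝ (v.toLp t) (r t • f t))) := by
    intro f hf
    have h := hg (hf.toLp f)
    have e1 : inner ℝ g (hf.toLp f) = ∫ t, inner ℝ (v.toLp t) (r t • f t) := by
      rw [L2.inner_def]
      refine integral_congr_ae ?_
      filter_upwards [hv, hf.coeFn_toLp] with t h1 h2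
      rw [h1, h2, inner_smul_left, inner_smul_right]
      simp only [conj_trivial]
      rw [inv_mul_cancel_left₀ (hr t).ne']
    have e2 : ∀ u : Control Ω, inner ℝ ((hmem u).toLp _) (hf.toLp f) =
        ∫ t, inner ℝ (u.toLp t) (r t • f t) := by
      intro u
      rw [L2.inner_def]
      refine integral_congr_ae ?_
      filter_upwards [(hmem u).coeFn_toLp, hf.coeFn_toLp] with t h1 h2
      rw [h1, h2, inner_smul_left, inner_smul_right]
      rfl
    simpa only [e1, e2] using h
  refine (tendsto_nhds_iff hτ (f := id) (l := (F : Filter (Control Ω)))).2 fun y => ?_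
  have hy : Integrable y := L1.integrable_coeFn y
  -- On `A N` the quotient `y / r` is bounded by `N * r`, hence in `L²`, so `hpair` applies to the
  -- truncation. As `r > 0`, these sets exhaust `ℝ`.
  let A : ℕ → Set ℝ := fun N => {t | ‖y t‖ ≤ N * r t ^ 2}
  have hA : ∀ N, MeasurableSet (A N) := fun N =>
    measurableSet_le (Lp.stronglyMeasurable y).norm.measurable
      ((hrc.pow 2).measurable.const_mul _)
  have hyN : ∀ N, Integrable ((A N).indicator y) := fun N => hy.indicator (hA N)
  have hlim : Tendsto (fun N => ∫ t, ‖y t - (A N).indicator y t‖) atTop (𝓝 0) := by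
    have h0 : (0 : ℝ) = ∫ _ : ℝ, (0 : ℝ) := by simp
    rw [h0]
    refine tendsto_integral_of_dominated_convergence (fun t => ‖y t‖)
      (fun N => (hy.sub (hyN N)).norm.1) hy.norm (fun N => Eventually.of_forall fun t => ?_)
      (Eventually.of_forall fun t => ?_)
    · by_cases ht : t ∈ A N <;> simp [ht]
    · obtain ⟨N₀, hN₀⟩ := exists_nat_ge (‖y t‖ / r t ^ 2)
      refine tendsto_const_nhds.congr' ?_
      filter_upwards [eventually_ge_atTop N₀] with N hN
      have ht : t ∈ A N := by
        have h2 : 0 < r t ^ 2 := pow_pos (hr t) 2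
        rw [div_le_iff₀ h2] at hN₀
        refine hN₀.trans ?_
        gcongr
      simp [ht]
  have happrox : ∀ N, Tendsto (fun u : Control Ω => ∫ t, inner ℝ (u.toLp t) ((A N).indicator y t))
      F (𝓝 (∫ t, inner ℝ (v.toLp t) ((A N).indicator y t))) := by
    intro N
    have h := hpair (fun t => (r t)⁻¹ • (A N).indicator y t) ?_
    · simpa only [smul_inv_smul₀ (hr _).ne'] using h
    · refine (hr2.const_mul N).mono' ((hrc.inv₀ fun t => (hr t).ne').aestronglyMeasurable.smul
        (hyN N).1) (Eventually.of_forall fun t => ?_)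
      rw [norm_smul, norm_inv, Real.norm_of_nonneg (hr t).le, inv_mul_le_iff₀ (hr t)]
      by_cases ht : t ∈ A N
      · rw [indicator_of_mem ht]
        exact ht.trans_eq (by ring)
      · rw [indicator_of_notMem ht, norm_zero]
        have := hr t
        positivity
  have hC' : ∀ x ∈ Ω, ‖x‖ ≤ |C| := fun x hx => (hC x hx).trans (le_abs_self _)
  rw [Metric.tendsto_nhds]
  intro ε hε
  obtain ⟨N, hN⟩ := ((hlim.const_mul |C|).eventually
    (gt_mem_nhds (show |C| * 0 < ε / 3 by simpa using by linarith))).exists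
  filter_upwards [Metric.tendsto_nhds.1 (happrox N) (ε / 3) (by linarith)] with u hu
  have h1 := u.dist_integral_inner_le hC' hy (hyN N)
  have h2 := v.dist_integral_inner_le hC' hy (hyN N)
  rw [dist_comm] at h2
  have h3 := dist_triangle4 (∫ t, inner ℝ (u.toLp t) (y t))
    (∫ t, inner ℝ (u.toLp t) ((A N).indicator y t)) (∫ t, inner ℝ (v.toLp t) ((A N).indicator y t))
    (∫ t, inner ℝ (v.toLp t) (y t))
  simp only [id]
  linarith

open Filter in
/-- Controls that agree on a large interval around `0` are close in the weak-* topology. -/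
theorem exists_forall_dist_lt [dU : MetricSpace (Control Ω)]
    (hdU : dU.toUniformSpace.toTopologicalSpace = weakStarTopology Ω)
    (hΩ : Bornology.IsBounded Ω) (u : Control Ω) {δ : ℝ} (hδ : 0 < δ) :
    ∃ R₀ : ℝ, ∀ R ≥ R₀, ∀ w : Control Ω,
      (∀ᵐ t, -R ≤ t → t < R → w.toLp t = u.toLp t) → dist w u < δ := by
  by_contra! H
  -- Counterexamples with `R k ≥ k` eventually agree with `u` at almost every time, so dominated
  -- convergence forces them to converge to `u`.
  choose R hR w hw hd using fun k : ℕ => H k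
  obtain ⟨C, hC⟩ := hΩ.exists_norm_le
  have hlim : Tendsto w atTop (𝓝 u) := by
    refine (tendsto_nhds_iff hdU).2 fun y => ?_
    have hy : Integrable y := L1.integrable_coeFn y
    refine tendsto_integral_of_dominated_convergence (fun t => C * ‖y t‖)
      (fun k => ((w k).integrable_inner hΩ hy).1) (hy.norm.const_mul C) (fun k => ?_) ?_
    · filter_upwards [(w k).mem] with t ht
      exact (norm_inner_le_norm _ _).trans (by gcongr; exact hC _ ht)
    · filter_upwards [ae_all_iff.2 hw] with t ht
      obtain ⟨k₀, hk₀⟩ := exists_nat_gt |t|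
      refine tendsto_const_nhds.congr' ?_
      filter_upwards [eventually_ge_atTop k₀] with k hk
      have h1 : |t| < R k := hk₀.trans_le ((Nat.cast_le.2 hk).trans (hR k))
      rw [ht k (abs_lt.1 h1).1.le (abs_lt.1 h1).2]
  obtain ⟨k, hk⟩ := (Metric.tendsto_nhds.1 hlim δ hδ).exists
  exact absurd hk (not_lt.2 (hd k))

end Control

/-! ### Projecting and lifting chains -/

theorem HasChain.of_transGen {X : Type*} [MetricSpace X] {Ψ : ℝ → X → X} {ε : X → ℝ} {T : ℝ}
    {x y : X}
    (h : Relation.TransGen (fun p q => ∃ τ, T ≤ τ ∧ dist (Ψ τ p) q < ε (Ψ τ p)) x y) :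
    HasChain Ψ ε T x y := by
  induction h with
  | @single y h =>
    obtain ⟨τ, hτ, hd⟩ := h
    refine ⟨1, fun j => if j = 0 then x else y, fun _ => τ, le_rfl, rfl, rfl, fun j hj => ?_⟩
    obtain rfl : j = 0 := by lia
    exact ⟨hτ, hd⟩
  | @tail y z _ h ih =>
    obtain ⟨s, hs, hd⟩ := h
    obtain ⟨k, p, τ, hk, h0, hpk, H⟩ := ih
    refine ⟨k + 1, fun j => if j ≤ k then p j else z, fun j => if j < k then τ j else s,
      by lia, by simpa using h0, by simp, fun j hj => ?_⟩
    rcases Nat.lt_succ_iff_lt_or_eq.1 hj with h | rfl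
    · simpa [h, h.le, Nat.succ_le_of_lt h] using H j h
    · simpa [hpk] using And.intro hs hd

namespace Control

variable {m : ℕ} {Ω : Set (EuclideanSpace ℝ (Fin m))}

/-- If `p` agrees in forward time with the concatenation of `u` and the translate of `v` at the
time `τ`, then its shift by `τ` agrees in forward time with `v`. -/
theorem exists_concat_shift {τ : ℝ} (hτ : 0 ≤ τ) (u v : Control Ω) :
    ∃ w : Control Ω, ∀ p : Control Ω, (∀ᵐ t, 0 ≤ t → p.toLp t = w.toLp t) →
      (∀ᵐ t, 0 ≤ t → t < τ → p.toLp t = u.toLp t) ∧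
        ∀ᵐ t, 0 ≤ t → (p.shift τ).toLp t = v.toLp t := by
  obtain ⟨w, hw⟩ := exists_concat τ u (v.shift (-τ))
  refine ⟨w, fun p hp => ⟨?_, ?_⟩⟩
  · filter_upwards [hp, hw] with t h1 h2 h0 hlt
    rw [h1 h0, h2, if_pos hlt]
  · filter_upwards [p.ae_shift τ, ae_comp_const_add hp τ, ae_comp_const_add hw τ,
      ae_comp_const_add (v.ae_shift (-τ)) τ] with t h1 h2 h3 h4 h0
    rw [h1, h2 (by linarith), h3, if_neg (by linarith), h4]
    simp

end Control

/-- A jump function on a product with a compact factor is bounded below by a jump function on the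
other factor. -/
theorem IsJumpFunction.exists_le_prod {X Y : Type*} [TopologicalSpace X] [TopologicalSpace Y]
    [CompactSpace X] [Nonempty X] {ε : X × Y → ℝ} (hε : IsJumpFunction ε) :
    ∃ η : Y → ℝ, IsJumpFunction η ∧ ∀ x y, η y ≤ ε (x, y) := by
  have hc : ∀ y, Continuous fun x => ε (x, y) := fun y => hε.1.comp (.prodMk_left y)
  -- Compactness makes the infimum over `X` continuous in `y`, and attained, hence positive.
  refine ⟨fun y => sInf ((fun x => ε (x, y)) '' univ), ⟨?_, fun y => ?_⟩, fun x y => ?_⟩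
  · exact isCompact_univ.continuous_sInf (f := fun y x => ε (x, y)) (hε.1.comp continuous_swap)
  · obtain ⟨x, -, hx⟩ := isCompact_univ.exists_sInf_image_eq univ_nonempty (hc y).continuousOn
    exact (hε.2 _).trans_eq hx.symm
  · exact csInf_le (isCompact_univ.image (hc y)).bddBelow ⟨x, mem_univ x, rfl⟩

namespace ControlAffineSystem

variable {n m : ℕ} {M : Type*} [MetricSpace M] [ChartedSpace (EuclideanSpace ℝ (Fin n)) M]
  [IsManifold (𝓡 n) ∞ M] {S : ControlAffineSystem n m M} {hS : S.UniqueGlobalSolutions}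

theorem HasControlledChain.transGen {ε : M → ℝ} {T : ℝ} {x y : M}
    (h : S.HasControlledChain hS ε T x y) :
    Relation.TransGen (fun p q => ∃ (u : Control S.Ω) (τ : ℝ), T ≤ τ ∧
      dist (S.φ hS τ p u) q < ε (S.φ hS τ p u)) x y := by
  obtain ⟨k, p, u, τ, hk, rfl, rfl, H⟩ := h
  induction k, hk using Nat.le_induction with
  | base => exact .single ⟨u 0, τ 0, H 0 one_pos⟩
  | succ k hk ih =>
    exact (ih fun j hj => H j (by lia)).tail ⟨u k, τ k, H k (by lia)⟩

theorem isInvariant_lift (E : Set M) : IsInvariant (S.controlFlow hS) (S.lift hS E) := by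
  intro t p hp s
  simp only [controlFlow, φ_φ_shift]
  exact hp (t + s)

variable [dU : MetricSpace (Control S.Ω)]

/-- A controlled chain lifts to a chain of the control flow without jumps in the controls. The
control after the end of the chain can be prescribed. -/
theorem exists_transGen_controlFlow {ε : Control S.Ω × M → ℝ} {η : M → ℝ} {T : ℝ} (hT : 0 < T)
    (hη : ∀ x, 0 < η x) (hηε : ∀ u x, η x ≤ ε (u, x)) {x y : M}
    (h : Relation.TransGen (fun p q => ∃ (u : Control S.Ω) (τ : ℝ), T ≤ τ ∧
      dist (S.φ hS τ p u) q < η (S.φ hS τ p u)) x y) (v : Control S.Ω) :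
    ∃ w : Control S.Ω, ∀ p : Control S.Ω, (∀ᵐ t, 0 ≤ t → p.toLp t = w.toLp t) →
      ∃ q : Control S.Ω, (∀ᵐ t, 0 ≤ t → q.toLp t = v.toLp t) ∧
        Relation.TransGen (fun p q => ∃ τ, T ≤ τ ∧ dist (S.controlFlow hS τ p) q <
          ε (S.controlFlow hS τ p)) (p, x) (q, y) := by
  have step : ∀ (x z : M) (u p : Control S.Ω) (τ : ℝ), T ≤ τ →
      dist (S.φ hS τ x u) z < η (S.φ hS τ x u) →
      (∀ᵐ t, 0 ≤ t → t < τ → p.toLp t = u.toLp t) →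
      ∃ σ, T ≤ σ ∧ dist (S.controlFlow hS σ (p, x)) (p.shift τ, z) <
        ε (S.controlFlow hS σ (p, x)) := by
    intro x z u p τ hτ hd hp
    refine ⟨τ, hτ, ?_⟩
    rw [← φ_congr hS (hT.le.trans hτ) x hp] at hd
    rw [Prod.dist_eq]
    simp only [controlFlow, dist_self]
    exact (max_lt (hη _) hd).trans_le (hηε _ _)
  -- The control for the rest of the chain is built first and the current one put in front. Only
  -- forward agreement is asked of `p`, since after a shift its past records the earlier links.
  induction h using Relation.TransGen.head_induction_on with
  | @single x h =>
    obtain ⟨u, τ, hτ, hd⟩ := h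
    obtain ⟨w, hw⟩ := Control.exists_concat_shift (hT.le.trans hτ) u v
    exact ⟨w, fun p hp => ⟨p.shift τ, (hw p hp).2, .single (step x y u p τ hτ hd (hw p hp).1)⟩⟩
  | @head x z h _ ih =>
    obtain ⟨u, τ, hτ, hd⟩ := h
    obtain ⟨w', hw'⟩ := ih
    obtain ⟨w, hw⟩ := Control.exists_concat_shift (hT.le.trans hτ) u w'
    refine ⟨w, fun p hp => ?_⟩
    obtain ⟨q, hq, hpq⟩ := hw' (p.shift τ) (hw p hp).2
    exact ⟨q, hq, .head (step x z u p τ hτ hd (hw p hp).1) hpq⟩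

/-- The lift of a set whose points are strongly chain controllable to each other is strongly chain
transitive. -/
theorem isStronglyChainTransitive_lift
    (hdU : dU.toUniformSpace.toTopologicalSpace = Control.weakStarTopology S.Ω) {E : Set M}
    (hE : ∀ x ∈ E, ∀ y ∈ E, S.StronglyChainControllable hS x y) :
    IsStronglyChainTransitive (S.controlFlow hS) (S.lift hS E) := by
  rintro ⟨u, x⟩ hx ⟨v, y⟩ hy T hT ε hε
  have := Control.compactSpace hdU S.convex S.isCompact
  have : Nonempty (Control S.Ω) := ⟨u⟩
  obtain ⟨η, hη, hηε⟩ := hε.exists_le_prod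
  obtain ⟨R₁, hR₁⟩ := Control.exists_forall_dist_lt hdU S.isCompact.isBounded (u.shift T)
    (hε.2 (S.controlFlow hS T (u, x)))
  -- The last jump starts at state `y` with a control not yet known; the tolerance `η y` serves
  -- every control, so `R` can be fixed before the chain.
  obtain ⟨R₂, hR₂⟩ := Control.exists_forall_dist_lt hdU S.isCompact.isBounded v (hη.2 y)
  obtain ⟨R, hRT, hR₁R, hR₂R⟩ : ∃ R, T ≤ R ∧ R₁ ≤ R ∧ R₂ ≤ R :=
    ⟨max T (max R₁ R₂), by simp, by simp, by simp⟩
  have hR0 : 0 ≤ R := hT.le.trans hRT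
  have hchain := (hE _ (hx (T + R)) _ (hy (-R)) T hT η hη).transGen
  obtain ⟨w, hw⟩ := exists_transGen_controlFlow hT hη.2 hηε hchain (v.shift (-R))
  obtain ⟨p, hp⟩ := Control.exists_concat R (u.shift T) (w.shift (-R))
  have hpw : ∀ᵐ t, 0 ≤ t → (p.shift R).toLp t = w.toLp t := by
    filter_upwards [p.ae_shift R, Control.ae_comp_const_add hp R,
      Control.ae_comp_const_add (w.ae_shift (-R)) R] with t h1 h2 h3 h0
    rw [h1, h2, if_neg (by linarith), h3]
    simp
  obtain ⟨q, hq, hpq⟩ := hw _ hpw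
  -- Three links are added: flow for time `T` and jump from `u.shift T` to `p`; flow for time `R`
  -- without a jump; and, after the lifted chain, flow for time `R` to state `y` and jump to the
  -- control `v`.
  refine HasChain.of_transGen (.head (b := (p, S.φ hS T x u)) ⟨T, le_rfl, ?_⟩
    (.head (b := (p.shift R, S.φ hS (T + R) x u)) ⟨R, hRT, ?_⟩ (.tail hpq ⟨R, hRT, ?_⟩)))
  · rw [Prod.dist_eq]
    simp only [controlFlow, dist_self]
    refine max_lt ?_ (hε.2 _)
    rw [dist_comm]
    refine hR₁ R hR₁R p ?_
    filter_upwards [hp] with t h1 _ h2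
    rw [h1, if_pos h2]
  · have e : S.controlFlow hS R (p, S.φ hS T x u) = (p.shift R, S.φ hS (T + R) x u) := by
      rw [← φ_φ_shift]
      refine Prod.ext rfl (φ_congr hS hR0 _ ?_)
      filter_upwards [hp] with t h1 _ h2
      rw [h1, if_pos h2]
    rw [e, dist_self]
    exact hε.2 _
  · have e : S.controlFlow hS R (q, S.φ hS (-R) y v) = (q.shift R, y) := by
      refine Prod.ext rfl ((φ_congr hS (v := v.shift (-R)) hR0 _ ?_).trans ?_)
      · filter_upwards [hq] with t h1 h2 _ using h1 h2
      · rw [φ_φ_shift, neg_add_cancel, φ_zero]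
    rw [e, Prod.dist_eq]
    simp only [dist_self]
    refine max_lt ((hR₂ R hR₂R _ ?_).trans_le (hηε _ _)) (hε.2 _)
    filter_upwards [q.ae_shift R, Control.ae_comp_const_add hq R,
      Control.ae_comp_const_add (v.ae_shift (-R)) R] with t h1 h2 h3 h4 _
    rw [h1, h2 (by linarith), h3]
    simp

/-- The projection of a strongly chain transitive set consists of points that are strongly chain
controllable to each other. -/
theorem stronglyChainControllable_of_mem {L : Set (Control S.Ω × M)}
    (hL : IsStronglyChainTransitive (S.controlFlow hS) L) {p q : Control S.Ω × M} (hp : p ∈ L)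
    (hq : q ∈ L) : S.StronglyChainControllable hS p.2 q.2 := by
  intro T hT ε hε
  -- The product metric is a maximum, so it bounds the jump in `M`.
  obtain ⟨k, c, τ, hk, rfl, rfl, H⟩ := hL p hp q hq T hT (fun p => ε p.2)
    ⟨hε.1.comp continuous_snd, fun _ => hε.2 _⟩
  exact ⟨k, fun j => (c j).2, fun j => (c j).1, τ, hk, rfl, rfl, fun j hj =>
    ⟨(H j hj).1, (le_max_right _ _).trans_lt (H j hj).2⟩⟩

end ControlAffineSystem

/-! ### Transfer of maximality -/

theorem theorem3 {n m : ℕ} {M : Type*} [MetricSpace M]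
    [ChartedSpace (EuclideanSpace ℝ (Fin n)) M] [IsManifold (𝓡 n) ∞ M]
    (S : ControlAffineSystem n m M) (hS : S.UniqueGlobalSolutions)
    [dU : MetricSpace (Control S.Ω)]
    (hdU : dU.toUniformSpace.toTopologicalSpace = Control.weakStarTopology S.Ω) :
    (∀ E : Set M, S.IsStrongChainControlSet hS E →
      IsMaximalInvariantStronglyChainTransitive (S.controlFlow hS) (S.lift hS E)) ∧
    (∀ L : Set (Control S.Ω × M),
      IsMaximalInvariantStronglyChainTransitive (S.controlFlow hS) L →
      S.IsStrongChainControlSet hS {x : M | ∃ u : Control S.Ω, (u, x) ∈ L}) := by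
  have hlift : ∀ E : Set M, (E.Nonempty ∧ (∀ x ∈ E, ∀ y ∈ E, S.StronglyChainControllable hS x y) ∧
      ∀ x ∈ E, ∃ u : Control S.Ω, ∀ t : ℝ, S.φ hS t x u ∈ E) →
      (S.lift hS E).Nonempty ∧ IsInvariant (S.controlFlow hS) (S.lift hS E) ∧
        IsStronglyChainTransitive (S.controlFlow hS) (S.lift hS E) := by
    rintro E ⟨⟨x, hx⟩, hcc, hinv⟩
    obtain ⟨u, hu⟩ := hinv x hx
    exact ⟨⟨(u, x), hu⟩, ControlAffineSystem.isInvariant_lift E,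
      ControlAffineSystem.isStronglyChainTransitive_lift hdU hcc⟩
  have hproj : ∀ L : Set (Control S.Ω × M), (L.Nonempty ∧ IsInvariant (S.controlFlow hS) L ∧
      IsStronglyChainTransitive (S.controlFlow hS) L) →
      {x : M | ∃ u : Control S.Ω, (u, x) ∈ L}.Nonempty ∧
        (∀ x ∈ {x : M | ∃ u : Control S.Ω, (u, x) ∈ L},
          ∀ y ∈ {x : M | ∃ u : Control S.Ω, (u, x) ∈ L}, S.StronglyChainControllable hS x y) ∧
        ∀ x ∈ {x : M | ∃ u : Control S.Ω, (u, x) ∈ L}, ∃ u : Control S.Ω,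
          ∀ t : ℝ, S.φ hS t x u ∈ {x : M | ∃ u : Control S.Ω, (u, x) ∈ L} := by
    rintro L ⟨⟨p, hp⟩, hinv, hL⟩
    refine ⟨⟨p.2, p.1, hp⟩, ?_, ?_⟩
    · rintro x ⟨u, hu⟩ y ⟨v, hv⟩
      exact ControlAffineSystem.stronglyChainControllable_of_mem hL hu hv
    · rintro x ⟨u, hu⟩
      exact ⟨u, fun t => ⟨u.shift t, hinv t hu⟩⟩
  refine ⟨fun E hE => ⟨hlift E hE.prop, fun Z hZ hEZ p hp t => ?_⟩,
    fun L hL => ⟨hproj L hL.prop, fun F hF hLF x hx => ?_⟩⟩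
  -- The projection of `Z` contains `E` by (b), so maximality of `E` puts it inside `E`; invariance
  -- of `Z` carries this along whole trajectories.
  · refine hE.le_of_ge (hproj Z hZ) (fun x hx => ?_) ⟨p.1.shift t, hZ.2.1 t hp⟩
    obtain ⟨u, hu⟩ := hE.prop.2.2 x hx
    exact ⟨u, hEZ hu⟩
  · obtain ⟨u, hu⟩ := hF.2.2 x hx
    -- Invariance places `L` in the lift of `F`; maximality of `L` reverses this inclusion.
    exact ⟨u, hL.le_of_ge (hlift F hF) (fun p hp t => hLF ⟨p.1.shift t, hL.prop.2.1 t hp⟩) hu⟩
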